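/- A copula is a function $C\colon[0,1]^2\to[0,1]$ such that $C(u,0)=0=C(0,v)$, $C(u,1)=u$, $C(1,v)=v$ and $C(u,v)-C(u,y)-C(x,v)+C(x,y)\ge 0$ for all $u,v,x,y\in[0,1]$ with $x\le u$, $y\le v$. For copulas $C,D$ put $$(C*D)(x,y)=\int_0^1\partial_2C(x,t)\,\partial_1D(t,y)\,dt,\qquad x,y\in[0,1],$$ which is again a copula, and let $$\|C\|=\Bigl(\int_0^1\!\!\int_0^1\bigl((\partial_1C(x,y))^2+(\partial_2C(x,y))^2\bigr)\,dx\,dy\Bigr)^{1/2}$$ be the Sobolev norm of $C$. Let $U$ and $V$ be copulas. (1) If $\|U\|=1$ and $\|V\|=1$, then $\|U*V\|=1$. (2) If $\|U*V\|=1$, then $\|U\|=1$ if and only if $\|V\|=1$. -/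

import Mathlib

open unitInterval

/-- A bivariate copula: a function `C : [0,1]² → [0,1]` with the boundary values of a distribution
function with uniform margins, and with nonnegative mass on every rectangle. -/
structure Copula where
  toFun : I → I → I
  zero_right : ∀ u, toFun u 0 = 0
  zero_left : ∀ v, toFun 0 v = 0
  one_right : ∀ u, toFun u 1 = u
  one_left : ∀ v, toFun 1 v = v
  rect_nonneg : ∀ u v x y, x ≤ u → y ≤ v →
    0 ≤ (toFun u v : ℝ) - toFun u y - toFun x v + toFun x y

namespace Copula

/-- The copula as a real function of two real variables: arguments outside `[0,1]` are clamped to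
the nearest endpoint, so on `[0,1]²` this is the copula itself. -/
noncomputable def ext (C : Copula) (x y : ℝ) : ℝ :=
  C.toFun (Set.projIcc 0 1 zero_le_one x) (Set.projIcc 0 1 zero_le_one y)

/-- The partial derivative in the first variable. It is used at points with `0 < x < 1` (up to a
null set of `x`), where the clamping plays no role. -/
noncomputable def partial₁ (C : Copula) (x y : ℝ) : ℝ := deriv (fun s => C.ext s y) x

/-- The partial derivative in the second variable. -/
noncomputable def partial₂ (C : Copula) (x y : ℝ) : ℝ := deriv (fun t => C.ext x t) y

/-- The Sobolev norm `‖C‖ = (∫₀¹ ∫₀¹ ((∂₁C)² + (∂₂C)²) dx dy) ^ (1/2)`. -/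
noncomputable instance : Norm Copula where
  norm C := √(∫ y in (0 : ℝ)..1, ∫ x in (0 : ℝ)..1, (C.partial₁ x y ^ 2 + C.partial₂ x y ^ 2))

/-- The integral defining the product `C * D` at `(x, y)`. -/
noncomputable def starFun (C D : Copula) (x y : ℝ) : ℝ :=
  ∫ t in (0 : ℝ)..1, C.partial₂ x t * D.partial₁ t y

/-! Facts needed to see that the product of two copulas is a copula. -/

/-- The copula with its two variables exchanged. -/
def transpose (C : Copula) : Copula where
  toFun x y := C.toFun y x
  zero_right := C.zero_left
  zero_left := C.zero_right
  one_right := C.one_left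
  one_left := C.one_right
  rect_nonneg u v x y hx hy := by linarith [C.rect_nonneg v u y x hy hx]

theorem ext_rect (C : Copula) {u v x y : ℝ} (hx : x ≤ u) (hy : y ≤ v) :
    0 ≤ C.ext u v - C.ext u y - C.ext x v + C.ext x y :=
  C.rect_nonneg _ _ _ _ (Set.monotone_projIcc _ hx) (Set.monotone_projIcc _ hy)

theorem ext_zero_left (C : Copula) (y : ℝ) : C.ext 0 y = 0 := by
  simp [ext, C.zero_left]

theorem ext_zero_right (C : Copula) (x : ℝ) : C.ext x 0 = 0 := C.transpose.ext_zero_left x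

theorem ext_one_left (C : Copula) (y : ℝ) :
    C.ext 1 y = Set.projIcc (0 : ℝ) 1 zero_le_one y := by
  simp [ext, C.one_left]

theorem ext_nonpos_left (C : Copula) {x : ℝ} (hx : x ≤ 0) (y : ℝ) : C.ext x y = 0 := by
  have h : Set.projIcc (0 : ℝ) 1 zero_le_one x = 0 := Set.projIcc_of_le_left _ hx
  simp [ext, h, C.zero_left]

theorem ext_one_le_left (C : Copula) {x : ℝ} (hx : 1 ≤ x) (y : ℝ) : C.ext x y = C.ext 1 y := by
  have h : Set.projIcc (0 : ℝ) 1 zero_le_one x = 1 := Set.projIcc_of_right_le _ hx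
  simp [ext, h]

/-- The increment `C(u, ·) - C(x, ·)` is nondecreasing. -/
theorem monotone_sub (C : Copula) {x u : ℝ} (hx : x ≤ u) :
    Monotone fun t => C.ext u t - C.ext x t := by
  intro a b hab
  have := C.ext_rect hx hab
  simp only
  linarith

theorem monotone_right (C : Copula) (x : ℝ) : Monotone fun t => C.ext x t := by
  rcases le_total x 0 with h | h
  · intro a b _
    simp [C.ext_nonpos_left h]
  · have := C.monotone_sub h
    simpa [C.ext_zero_left] using this

theorem lipschitz_right (C : Copula) (x : ℝ) : LipschitzWith 1 fun t => C.ext x t := by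
  refine LipschitzWith.of_le_add_mul 1 fun a b => ?_
  rcases le_total a b with h | h
  · have := C.monotone_right x h
    simp only at this
    have hd : 0 ≤ dist a b := dist_nonneg
    simp only [NNReal.coe_one, one_mul]
    linarith
  · have h1 : C.ext x a - C.ext x b ≤ C.ext 1 a - C.ext 1 b := by
      rcases le_total x 1 with hx | hx
      · linarith [C.ext_rect hx h]
      · rw [C.ext_one_le_left hx, C.ext_one_le_left hx]
    have h2 : C.ext 1 a - C.ext 1 b ≤ dist a b := by
      rw [C.ext_one_left, C.ext_one_left, Real.dist_eq, abs_of_nonneg (sub_nonneg.2 h)]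
      have := Set.abs_projIcc_sub_projIcc (zero_le_one (α := ℝ)) (c := a) (d := b)
      rw [abs_of_nonneg (sub_nonneg.2 h)] at this
      exact (le_abs_self _).trans this
    simp only [NNReal.coe_one, one_mul]
    linarith

theorem partial₂_nonneg (C : Copula) (x t : ℝ) : 0 ≤ C.partial₂ x t :=
  (C.monotone_right x).deriv_nonneg

theorem partial₂_le_one (C : Copula) (x t : ℝ) : C.partial₂ x t ≤ 1 := by
  have := norm_deriv_le_of_lipschitz (C.lipschitz_right x) (x₀ := t)
  exact (le_abs_self _).trans (by simpa [partial₂] using this)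

theorem measurable_partial₂ (C : Copula) (x : ℝ) : Measurable fun t => C.partial₂ x t :=
  measurable_deriv _

theorem ae_partial₂_mono (C : Copula) {x u : ℝ} (hx : x ≤ u) :
    ∀ᵐ t, C.partial₂ x t ≤ C.partial₂ u t := by
  filter_upwards [(C.lipschitz_right x).ae_differentiableAt_real,
    (C.lipschitz_right u).ae_differentiableAt_real] with t h1 h2
  have h := (C.monotone_sub hx).deriv_nonneg (x := t)
  rw [deriv_fun_sub h2 h1] at h
  exact sub_nonneg.1 h

theorem partial₁_eq (C : Copula) (x y : ℝ) : C.partial₁ x y = C.transpose.partial₂ y x := rfl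

theorem integrand_mem (C D : Copula) (x y t : ℝ) :
    C.partial₂ x t * D.partial₁ t y ∈ Set.Icc (0 : ℝ) 1 := by
  rw [partial₁_eq]
  exact ⟨mul_nonneg (C.partial₂_nonneg _ _) (D.transpose.partial₂_nonneg _ _),
    mul_le_one₀ (C.partial₂_le_one _ _) (D.transpose.partial₂_nonneg _ _)
      (D.transpose.partial₂_le_one _ _)⟩

theorem integrand_integrable (C D : Copula) (x y : ℝ) :
    IntervalIntegrable (fun t => C.partial₂ x t * D.partial₁ t y) MeasureTheory.volume 0 1 := by
  refine (intervalIntegrable_const (c := (1 : ℝ))).mono_fun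
    ((C.measurable_partial₂ x).mul (D.transpose.measurable_partial₂ y)).aestronglyMeasurable
    (Filter.Eventually.of_forall fun t => ?_)
  have h := C.integrand_mem D x y t
  simp only [Real.norm_eq_abs, abs_one]
  rw [abs_of_nonneg h.1]
  exact h.2

theorem starFun_mem (C D : Copula) (x y : ℝ) : C.starFun D x y ∈ Set.Icc (0 : ℝ) 1 := by
  constructor
  · exact intervalIntegral.integral_nonneg zero_le_one fun t _ => (C.integrand_mem D x y t).1
  · have := intervalIntegral.integral_mono_on zero_le_one (C.integrand_integrable D x y)
      (intervalIntegrable_const (c := (1 : ℝ))) fun t _ => (C.integrand_mem D x y t).2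
    simpa [starFun] using this

theorem starFun_transpose (C D : Copula) (x y : ℝ) :
    C.starFun D x y = D.transpose.starFun C.transpose y x := by
  simp only [starFun, partial₁_eq]
  exact intervalIntegral.integral_congr fun t _ => mul_comm _ _

theorem starFun_zero_left (C D : Copula) (y : ℝ) : C.starFun D 0 y = 0 := by
  have h : ∀ t, C.partial₂ 0 t = 0 := fun t => by simp [partial₂, C.ext_zero_left]
  simp [starFun, h]

theorem starFun_one_left (C D : Copula) (y : I) : C.starFun D 1 y = y := by
  have h : ∀ t ∈ Set.Ioo (0 : ℝ) 1, C.partial₂ 1 t = 1 := by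
    intro t ht
    have : (fun t => C.ext 1 t) =ᶠ[nhds t] fun t => t := by
      filter_upwards [isOpen_Ioo.mem_nhds ht] with s hs
      rw [C.ext_one_left, Set.projIcc_of_mem _ (Set.Ioo_subset_Icc_self hs)]
    rw [partial₂, this.deriv_eq, deriv_id'']
  have h2 : C.starFun D 1 y = ∫ t in (0 : ℝ)..1, D.partial₁ t y := by
    rw [starFun, intervalIntegral.integral_of_le zero_le_one,
      intervalIntegral.integral_of_le zero_le_one, MeasureTheory.integral_Ioc_eq_integral_Ioo,
      MeasureTheory.integral_Ioc_eq_integral_Ioo]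
    refine MeasureTheory.setIntegral_congr_fun measurableSet_Ioo fun t ht => ?_
    simp only [h t ht, one_mul]
  have hac := ((D.transpose.lipschitz_right y).lipschitzOnWith
    (s := Set.uIcc 0 1)).absolutelyContinuousOnInterval
  rw [h2]
  refine hac.integral_deriv_eq_sub.trans ?_
  change D.ext 1 y - D.ext 0 y = y
  rw [D.ext_zero_left, D.ext_one_left, Set.projIcc_val, sub_zero]

theorem starFun_rect (C D : Copula) {u v x y : ℝ} (hx : x ≤ u) (hy : y ≤ v) :
    0 ≤ C.starFun D u v - C.starFun D u y - C.starFun D x v + C.starFun D x y := by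
  have e : C.starFun D u v - C.starFun D u y - C.starFun D x v + C.starFun D x y =
      ∫ t in (0 : ℝ)..1, (C.partial₂ u t * D.partial₁ t v - C.partial₂ u t * D.partial₁ t y
        - C.partial₂ x t * D.partial₁ t v + C.partial₂ x t * D.partial₁ t y) := by
    have i1 := C.integrand_integrable D u v
    have i2 := C.integrand_integrable D u y
    have i3 := C.integrand_integrable D x v
    have i4 := C.integrand_integrable D x y
    rw [intervalIntegral.integral_add ((i1.sub i2).sub i3) i4,
      intervalIntegral.integral_sub (i1.sub i2) i3, intervalIntegral.integral_sub i1 i2]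
    rfl
  rw [e]
  refine intervalIntegral.integral_nonneg_of_ae zero_le_one ?_
  filter_upwards [C.ae_partial₂_mono hx, D.transpose.ae_partial₂_mono hy] with t h1 h2
  have := mul_nonneg (sub_nonneg.2 h1) (sub_nonneg.2 h2)
  simp only [partial₁_eq, Pi.zero_apply]
  linarith

/-- The product `(C * D)(x, y) = ∫₀¹ ∂₂C(x, t) ∂₁D(t, y) dt` on copulas. -/
noncomputable instance : Mul Copula where
  mul C D :=
    { toFun := fun x y => ⟨C.starFun D x y, C.starFun_mem D x y⟩
      zero_right := fun u => Subtype.ext <| by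
        simpa using (C.starFun_transpose D u 0).trans (starFun_zero_left _ _ _)
      zero_left := fun v => Subtype.ext <| by simpa using C.starFun_zero_left D v
      one_right := fun u => Subtype.ext <| by
        simpa using (C.starFun_transpose D u 1).trans (starFun_one_left _ _ _)
      one_left := fun v => Subtype.ext <| by simpa using C.starFun_one_left D v
      rect_nonneg := fun _ _ _ _ hx hy => C.starFun_rect D hx hy }

end Copula

/-! Copulas under `*` form a monoid with unit $M(x,y)=\min(x,y)$ and involution $C\mapsto C^T$, and
$\|C\|=1$ says exactly that $C^T$ is a two-sided inverse of $C$. Both claims are then algebra: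
invertible elements are closed under products, and an invertible factor can be cancelled.

The norm enters through $\int_0^1(\partial_2C(x,t))^2\,dt=(C*C^T)(x,x)$ and its mirror image, so
$\|C\|^2$ is the sum of the diagonal integrals of $C^T*C$ and $C*C^T$
(`norm_eq_sqrt_integral_diag`). Any copula $D$ has $D(t,t)\le t$, so each integral is at most $1/2$;
by continuity equality forces $D(t,t)=t$, hence $D=M$ (`integral_diag_eq_iff`).

The analytic work is associativity. The operator $T_Cf=\frac{d}{dx}\int_0^1\partial_2C(x,t)f(t)\,dt$
is a conditional expectation: positive, and contracting in $L^1$. Associativity amounts to $T_{C^T}$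
being the adjoint of $T_C$ (`integral_deriv_average_mul`). For indicators of half-lines this is the
fundamental theorem of calculus; a π-λ argument and $L^1$ density extend it to bounded measurable
functions. -/

namespace Copula

open MeasureTheory Filter Topology

/-! ### Bounded measurable functions -/

/-- Bounded measurable real functions. -/
def IsBoundedMeasurable (f : ℝ → ℝ) : Prop := Measurable f ∧ ∃ K : ℝ, ∀ x, |f x| ≤ K

namespace IsBoundedMeasurable

variable {f g : ℝ → ℝ}

theorem add (hf : IsBoundedMeasurable f) (hg : IsBoundedMeasurable g) :
    IsBoundedMeasurable fun x => f x + g x := by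
  obtain ⟨hf, K, hK⟩ := hf
  obtain ⟨hg, L, hL⟩ := hg
  exact ⟨hf.add hg, K + L, fun x => (abs_add_le _ _).trans (add_le_add (hK x) (hL x))⟩

theorem neg (hf : IsBoundedMeasurable f) : IsBoundedMeasurable fun x => -f x := by
  obtain ⟨hf, K, hK⟩ := hf
  exact ⟨hf.neg, K, fun x => by simpa using hK x⟩

theorem sub (hf : IsBoundedMeasurable f) (hg : IsBoundedMeasurable g) :
    IsBoundedMeasurable fun x => f x - g x := by
  simpa [sub_eq_add_neg] using hf.add hg.neg

theorem abs (hf : IsBoundedMeasurable f) : IsBoundedMeasurable fun x => |f x| := by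
  obtain ⟨hf, K, hK⟩ := hf
  exact ⟨hf.abs, K, fun x => by simpa using hK x⟩

theorem mul (hf : IsBoundedMeasurable f) (hg : IsBoundedMeasurable g) :
    IsBoundedMeasurable fun x => f x * g x := by
  obtain ⟨hf, K, hK⟩ := hf
  obtain ⟨hg, L, hL⟩ := hg
  refine ⟨hf.mul hg, K * L, fun x => ?_⟩
  rw [abs_mul]
  exact mul_le_mul (hK x) (hL x) (abs_nonneg _) ((abs_nonneg _).trans (hK x))

theorem const (c : ℝ) : IsBoundedMeasurable fun _ => c :=
  ⟨measurable_const, |c|, fun _ => le_rfl⟩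

theorem indicator {s : Set ℝ} (hs : MeasurableSet s) (hf : IsBoundedMeasurable f) :
    IsBoundedMeasurable (s.indicator f) := by
  obtain ⟨hf, K, hK⟩ := hf
  refine ⟨hf.indicator hs, K, fun x => ?_⟩
  have := norm_indicator_le_norm_self (s := s) f x
  exact this.trans (hK x)

theorem integrable (hf : IsBoundedMeasurable f) (μ : Measure ℝ) [IsFiniteMeasure μ] :
    Integrable f μ := by
  obtain ⟨hf, K, hK⟩ := hf
  exact Integrable.of_bound hf.aestronglyMeasurable K (Eventually.of_forall hK)

theorem intervalIntegrable (hf : IsBoundedMeasurable f) (a b : ℝ) :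
    IntervalIntegrable f volume a b := by
  obtain ⟨hf, K, hK⟩ := hf
  exact (intervalIntegrable_const (c := K)).mono_fun hf.aestronglyMeasurable
    (Eventually.of_forall fun x => (hK x).trans (le_abs_self K))

end IsBoundedMeasurable

/-! ### Sections of a copula and integrals over the unit interval -/

theorem isBoundedMeasurable_partial₂ (C : Copula) (x : ℝ) :
    IsBoundedMeasurable fun t => C.partial₂ x t :=
  ⟨C.measurable_partial₂ x, 1, fun t => by
    rw [abs_of_nonneg (C.partial₂_nonneg x t)]; exact C.partial₂_le_one x t⟩

theorem isBoundedMeasurable_partial₁ (C : Copula) (y : ℝ) :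
    IsBoundedMeasurable fun t => C.partial₁ t y :=
  C.transpose.isBoundedMeasurable_partial₂ y

theorem ext_projIcc_left (C : Copula) (x y : ℝ) :
    C.ext (Set.projIcc (0 : ℝ) 1 zero_le_one x) y = C.ext x y := by
  simp [ext]

theorem ext_projIcc_right (C : Copula) (x y : ℝ) :
    C.ext x (Set.projIcc (0 : ℝ) 1 zero_le_one y) = C.ext x y := by
  simp [ext]

theorem integral_partial₂ (C : Copula) (x a : ℝ) :
    ∫ t in (0 : ℝ)..a, C.partial₂ x t = C.ext x a := by
  have hac := ((C.lipschitz_right x).lipschitzOnWith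
    (s := Set.uIcc 0 a)).absolutelyContinuousOnInterval
  refine hac.integral_deriv_eq_sub.trans ?_
  simp [C.ext_zero_right]

theorem partial₂_one (C : Copula) {t : ℝ} (ht : t ∈ Set.Ioo (0 : ℝ) 1) : C.partial₂ 1 t = 1 := by
  have : (fun t => C.ext 1 t) =ᶠ[𝓝 t] fun t => t := by
    filter_upwards [isOpen_Ioo.mem_nhds ht] with s hs
    rw [C.ext_one_left, Set.projIcc_of_mem _ (Set.Ioo_subset_Icc_self hs)]
  rw [partial₂, this.deriv_eq, deriv_id'']

theorem integral_congr_Ioo {f g : ℝ → ℝ} {a b : ℝ} (hab : a ≤ b)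
    (h : ∀ t ∈ Set.Ioo a b, f t = g t) :
    ∫ t in a..b, f t = ∫ t in a..b, g t := by
  rw [intervalIntegral.integral_of_le hab, intervalIntegral.integral_of_le hab,
    integral_Ioc_eq_integral_Ioo, integral_Ioc_eq_integral_Ioo]
  exact setIntegral_congr_fun measurableSet_Ioo h

theorem integral_indicator_Iic {f : ℝ → ℝ} (a : ℝ) :
    ∫ t in (0 : ℝ)..1, (Set.Iic a).indicator f t =
      ∫ t in (0 : ℝ)..(Set.projIcc (0 : ℝ) 1 zero_le_one a), f t := by
  rw [intervalIntegral.integral_of_le zero_le_one,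
    intervalIntegral.integral_of_le (Set.projIcc (0 : ℝ) 1 zero_le_one a).2.1,
    setIntegral_indicator measurableSet_Iic]
  congr 2
  ext t
  simp only [Set.mem_inter_iff, Set.mem_Ioc, Set.mem_Iic, Set.coe_projIcc, le_max_iff, le_min_iff]
  constructor
  · rintro ⟨⟨h0, h1⟩, h⟩
    exact ⟨h0, Or.inr ⟨h1, h⟩⟩
  · rintro ⟨h0, h | ⟨h1, h⟩⟩
    · exact absurd h0 (not_lt.2 h)
    · exact ⟨⟨h0, h1⟩, h⟩

/-! ### The averaging operator of a copula -/

/-- The primitive of the conditional expectation of `f` under the copula `C`. -/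
noncomputable def average (C : Copula) (f : ℝ → ℝ) (x : ℝ) : ℝ :=
  ∫ t in (0 : ℝ)..1, C.partial₂ x t * f t

theorem average_zero (C : Copula) (f : ℝ → ℝ) : C.average f 0 = 0 := by
  have h : ∀ t, C.partial₂ 0 t = 0 := fun t => by simp [partial₂, C.ext_zero_left]
  simp [average, h]

theorem average_one (C : Copula) (f : ℝ → ℝ) : C.average f 1 = ∫ t in (0 : ℝ)..1, f t :=
  integral_congr_Ioo zero_le_one fun t ht => by rw [C.partial₂_one ht, one_mul]

theorem average_projIcc (C : Copula) (f : ℝ → ℝ) (x : ℝ) :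
    C.average f (Set.projIcc (0 : ℝ) 1 zero_le_one x) = C.average f x := by
  simp [average, partial₂, ext_projIcc_left]

theorem average_const (C : Copula) (c x : ℝ) :
    C.average (fun _ => c) x = c * Set.projIcc (0 : ℝ) 1 zero_le_one x := by
  rw [average, intervalIntegral.integral_mul_const, integral_partial₂, mul_comm]
  exact congrArg (c * ·) (C.transpose.ext_one_left x)

theorem average_indicator_Iic (C : Copula) (a x : ℝ) :
    C.average ((Set.Iic a).indicator fun _ => 1) x = C.ext x a := by
  rw [← C.ext_projIcc_right, ← C.integral_partial₂, ← integral_indicator_Iic, average]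
  refine intervalIntegral.integral_congr fun t _ => ?_
  by_cases h : t ∈ Set.Iic a <;> simp [h]

variable {f g : ℝ → ℝ}

theorem average_add (C : Copula) (hf : IsBoundedMeasurable f) (hg : IsBoundedMeasurable g)
    (x : ℝ) : C.average (fun t => f t + g t) x = C.average f x + C.average g x := by
  simp only [average, mul_add]
  have h := C.isBoundedMeasurable_partial₂ x
  exact intervalIntegral.integral_add ((h.mul hf).intervalIntegrable _ _)
    ((h.mul hg).intervalIntegrable _ _)

theorem average_sub (C : Copula) (hf : IsBoundedMeasurable f) (hg : IsBoundedMeasurable g)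
    (x : ℝ) : C.average (fun t => f t - g t) x = C.average f x - C.average g x := by
  simp only [average, mul_sub]
  have h := C.isBoundedMeasurable_partial₂ x
  exact intervalIntegral.integral_sub ((h.mul hf).intervalIntegrable _ _)
    ((h.mul hg).intervalIntegrable _ _)

/-- Positivity of the conditional expectation, in integrated form: for $x\le u$,
$\partial_2C(x,t)\le\partial_2C(u,t)$ for almost every $t$. -/
theorem monotone_average (C : Copula) (hf : IsBoundedMeasurable f) (h0 : ∀ t, 0 ≤ f t) :
    Monotone (C.average f) := by
  intro x u hx
  refine intervalIntegral.integral_mono_ae zero_le_one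
    (((C.isBoundedMeasurable_partial₂ x).mul hf).intervalIntegrable _ _)
    (((C.isBoundedMeasurable_partial₂ u).mul hf).intervalIntegrable _ _) ?_
  filter_upwards [C.ae_partial₂_mono hx] with t ht
  exact mul_le_mul_of_nonneg_right ht (h0 t)

/-- If $|f|\le K$ then $K\pm f\ge0$, so positivity bounds increments of the average of $f$ by those
of the average of $K$, which is $K$ times the clamping map. This gives a.e. differentiability and
the fundamental theorem of calculus. -/
theorem exists_lipschitzWith_average (C : Copula) (hf : IsBoundedMeasurable f) :
    ∃ K, LipschitzWith K (C.average f) := by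
  have hf' := hf
  obtain ⟨-, K, hK⟩ := hf'
  have hK0 : 0 ≤ K := (abs_nonneg _).trans (hK 0)
  refine ⟨K.toNNReal, LipschitzWith.of_le_add_mul _ fun a b => ?_⟩
  rw [Real.coe_toNNReal K hK0]
  have hp : |(Set.projIcc (0 : ℝ) 1 zero_le_one a : ℝ) - Set.projIcc (0 : ℝ) 1 zero_le_one b|
      ≤ dist a b := Set.abs_projIcc_sub_projIcc zero_le_one
  have hc := IsBoundedMeasurable.const K
  rcases le_total a b with h | h
  · have h1 := C.monotone_average (hc.add hf) (fun t => by linarith [neg_abs_le (f t), hK t]) h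
    rw [C.average_add hc hf, C.average_add hc hf, average_const, average_const] at h1
    have := mul_le_mul_of_nonneg_left ((neg_le_abs _).trans hp) hK0
    linarith
  · have h1 := C.monotone_average (hc.sub hf) (fun t => by linarith [le_abs_self (f t), hK t]) h
    rw [C.average_sub hc hf, C.average_sub hc hf, average_const, average_const] at h1
    have := mul_le_mul_of_nonneg_left ((le_abs_self _).trans hp) hK0
    linarith

theorem isBoundedMeasurable_deriv_average (C : Copula) (hf : IsBoundedMeasurable f) :
    IsBoundedMeasurable (deriv (C.average f)) := by
  obtain ⟨K, hK⟩ := C.exists_lipschitzWith_average hf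
  exact ⟨measurable_deriv _, K, fun x => norm_deriv_le_of_lipschitz hK⟩

theorem ae_differentiableAt_average (C : Copula) (hf : IsBoundedMeasurable f) :
    ∀ᵐ x, DifferentiableAt ℝ (C.average f) x := by
  obtain ⟨K, hK⟩ := C.exists_lipschitzWith_average hf
  exact hK.ae_differentiableAt_real

theorem integral_deriv_average (C : Copula) (hf : IsBoundedMeasurable f) (a : ℝ) :
    ∫ x in (0 : ℝ)..a, deriv (C.average f) x = C.average f a := by
  obtain ⟨K, hK⟩ := C.exists_lipschitzWith_average hf
  have hac := (hK.lipschitzOnWith (s := Set.uIcc 0 a)).absolutelyContinuousOnInterval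
  rw [hac.integral_deriv_eq_sub, average_zero, sub_zero]

theorem ae_deriv_average_add (C : Copula) (hf : IsBoundedMeasurable f)
    (hg : IsBoundedMeasurable g) :
    ∀ᵐ x, deriv (C.average fun t => f t + g t) x =
      deriv (C.average f) x + deriv (C.average g) x := by
  filter_upwards [C.ae_differentiableAt_average hf, C.ae_differentiableAt_average hg] with x h1 h2
  rw [← deriv_fun_add h1 h2]
  exact congrArg (deriv · x) (funext fun x => C.average_add hf hg x)

/-- Positivity applied to $|f|\pm f\ge0$. -/
theorem ae_abs_deriv_average_le (C : Copula) (hf : IsBoundedMeasurable f) :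
    ∀ᵐ x, |deriv (C.average f) x| ≤ deriv (C.average fun t => |f t|) x := by
  filter_upwards [C.ae_differentiableAt_average hf, C.ae_differentiableAt_average hf.abs]
    with x h1 h2
  have h3 : 0 ≤ deriv (fun x => C.average (fun t => |f t|) x - C.average f x) x := by
    refine Monotone.deriv_nonneg ?_
    simp only [← C.average_sub hf.abs hf]
    exact C.monotone_average (hf.abs.sub hf) fun t => sub_nonneg.2 (le_abs_self _)
  have h4 : 0 ≤ deriv (fun x => C.average (fun t => |f t|) x + C.average f x) x := by
    refine Monotone.deriv_nonneg ?_
    simp only [← C.average_add hf.abs hf]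
    exact C.monotone_average (hf.abs.add hf) fun t => by linarith [neg_abs_le (f t)]
  rw [deriv_fun_sub h2 h1] at h3
  rw [deriv_fun_add h2 h1] at h4
  exact abs_le.2 ⟨by linarith, by linarith⟩

/-- The conditional expectation contracts the `L¹` norm. -/
theorem integral_abs_deriv_average_le (C : Copula) (hf : IsBoundedMeasurable f) :
    ∫ x in (0 : ℝ)..1, |deriv (C.average f) x| ≤ ∫ t in (0 : ℝ)..1, |f t| := by
  rw [← C.average_one fun t => |f t|, ← C.integral_deriv_average hf.abs]
  exact intervalIntegral.integral_mono_ae zero_le_one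
    ((C.isBoundedMeasurable_deriv_average hf).abs.intervalIntegrable _ _)
    ((C.isBoundedMeasurable_deriv_average hf.abs).intervalIntegrable _ _)
    (C.ae_abs_deriv_average_le hf)

/-! ### Duality -/

/-- The difference of the two pairings which `integral_deriv_average_mul` identifies. -/
noncomputable def pairingDefect (C : Copula) (g f : ℝ → ℝ) : ℝ :=
  ∫ t in (0 : ℝ)..1, (deriv (C.transpose.average f) t * g t - f t * deriv (C.average g) t)

theorem isBoundedMeasurable_pairingDefect (C : Copula) (hg : IsBoundedMeasurable g)
    (hf : IsBoundedMeasurable f) : IsBoundedMeasurable fun t =>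
      deriv (C.transpose.average f) t * g t - f t * deriv (C.average g) t :=
  ((C.transpose.isBoundedMeasurable_deriv_average hf).mul hg).sub
    (hf.mul (C.isBoundedMeasurable_deriv_average hg))

theorem pairingDefect_add (C : Copula) {h : ℝ → ℝ} (hg : IsBoundedMeasurable g)
    (hf : IsBoundedMeasurable f) (hh : IsBoundedMeasurable h) :
    C.pairingDefect g (fun t => f t + h t) = C.pairingDefect g f + C.pairingDefect g h := by
  rw [pairingDefect, pairingDefect, pairingDefect, ← intervalIntegral.integral_add
    ((C.isBoundedMeasurable_pairingDefect hg hf).intervalIntegrable _ _)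
    ((C.isBoundedMeasurable_pairingDefect hg hh).intervalIntegrable _ _)]
  refine intervalIntegral.integral_congr_ae ?_
  filter_upwards [C.transpose.ae_deriv_average_add hf hh] with t ht _
  rw [ht]
  ring

/-- Makes the defect $L^1$-continuous in $f$, so that its zero set is closed. The constant adds
bounds for $g$ and for its conditional expectation, the first combined with the $L^1$ contraction.
-/
theorem exists_abs_pairingDefect_le (C : Copula) (hg : IsBoundedMeasurable g) :
    ∃ K : ℝ, ∀ f, IsBoundedMeasurable f →
      |C.pairingDefect g f| ≤ K * ∫ t in (0 : ℝ)..1, |f t| := by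
  obtain ⟨-, K, hK⟩ := id hg
  obtain ⟨-, L, hL⟩ := C.isBoundedMeasurable_deriv_average hg
  have hK0 : 0 ≤ K := (abs_nonneg _).trans (hK 0)
  refine ⟨K + L, fun f hf => ?_⟩
  have hd := (C.transpose.isBoundedMeasurable_deriv_average hf).abs
  calc |C.pairingDefect g f|
      ≤ ∫ t in (0 : ℝ)..1,
          |deriv (C.transpose.average f) t * g t - f t * deriv (C.average g) t| :=
        intervalIntegral.abs_integral_le_integral_abs zero_le_one
    _ ≤ ∫ t in (0 : ℝ)..1, (K * |deriv (C.transpose.average f) t| + L * |f t|) := by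
        refine intervalIntegral.integral_mono_on zero_le_one
          ((C.isBoundedMeasurable_pairingDefect hg hf).abs.intervalIntegrable _ _)
          ((((IsBoundedMeasurable.const K).mul hd).add
            ((IsBoundedMeasurable.const L).mul hf.abs)).intervalIntegrable _ _) fun t _ => ?_
        refine (abs_sub _ _).trans (add_le_add ?_ ?_)
        · rw [abs_mul, mul_comm]
          exact mul_le_mul_of_nonneg_right (hK t) (abs_nonneg _)
        · rw [abs_mul, mul_comm]
          exact mul_le_mul_of_nonneg_right (hL t) (abs_nonneg _)
    _ = K * (∫ t in (0 : ℝ)..1, |deriv (C.transpose.average f) t|)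
          + L * ∫ t in (0 : ℝ)..1, |f t| := by
        rw [intervalIntegral.integral_add ((hd.intervalIntegrable _ _).const_mul K)
          ((hf.abs.intervalIntegrable _ _).const_mul L), intervalIntegral.integral_const_mul,
          intervalIntegral.integral_const_mul]
    _ ≤ (K + L) * ∫ t in (0 : ℝ)..1, |f t| := by
        rw [add_mul]
        gcongr
        exact C.transpose.integral_abs_deriv_average_le hf

theorem pairingDefect_const_mul (C : Copula) (c : ℝ) (f : ℝ → ℝ) :
    C.pairingDefect g (fun t => c * f t) = c * C.pairingDefect g f := by
  have h : C.transpose.average (fun t => c * f t) = fun x => c * C.transpose.average f x := by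
    funext x
    simp only [average, mul_left_comm _ c]
    exact intervalIntegral.integral_const_mul _ _
  rw [pairingDefect, pairingDefect, ← intervalIntegral.integral_const_mul, h]
  refine intervalIntegral.integral_congr fun t _ => ?_
  simp only [deriv_const_mul_field]
  ring

theorem pairingDefect_eq_zero_of_approx (C : Copula) (hg : IsBoundedMeasurable g)
    (hf : IsBoundedMeasurable f) (h : ∀ ε > 0, ∃ f', IsBoundedMeasurable f' ∧
      C.pairingDefect g f' = 0 ∧ ∫ t in (0 : ℝ)..1, |f t - f' t| ≤ ε) :
    C.pairingDefect g f = 0 := by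
  obtain ⟨K, hK⟩ := C.exists_abs_pairingDefect_le hg
  refine abs_eq_zero.1 (le_antisymm (le_of_forall_pos_le_add fun ε hε => ?_) (abs_nonneg _))
  -- The sign of $K$ is unknown and it may vanish; $|K|+1$ is a positive bound for it.
  obtain ⟨f', hf', h0, hd⟩ := h (ε / (|K| + 1)) (by positivity)
  have e : C.pairingDefect g f = C.pairingDefect g (fun t => f t - f' t) := by
    have := C.pairingDefect_add hg (hf.sub hf') hf'
    simpa [h0] using this
  rw [e, zero_add]
  have hi : 0 ≤ ∫ t in (0 : ℝ)..1, |f t - f' t| :=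
    intervalIntegral.integral_nonneg zero_le_one fun t _ => abs_nonneg _
  calc _ ≤ _ := hK _ (hf.sub hf')
    _ ≤ (|K| + 1) * (ε / (|K| + 1)) :=
        mul_le_mul ((le_abs_self K).trans (by linarith)) hd hi (by positivity)
    _ = ε := by field_simp

/-- For $f=1_{(-\infty,a]}$ the transposed average is the section $C(a,\cdot)$, so the first pairing
is by definition the average of $g$ at $a$. The second integrates the derivative of that average
from $0$ to the clamped $a$. -/
theorem pairingDefect_indicator_Iic (C : Copula) (hg : IsBoundedMeasurable g) (a : ℝ) :
    C.pairingDefect g ((Set.Iic a).indicator fun _ => 1) = 0 := by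
  have h1 : IsBoundedMeasurable ((Set.Iic a).indicator fun _ => (1 : ℝ)) :=
    (IsBoundedMeasurable.const 1).indicator measurableSet_Iic
  have hd := C.isBoundedMeasurable_deriv_average hg
  rw [pairingDefect, intervalIntegral.integral_sub
    (((C.transpose.isBoundedMeasurable_deriv_average h1).mul hg).intervalIntegrable _ _)
    ((h1.mul hd).intervalIntegrable _ _), sub_eq_zero]
  have e1 : C.transpose.average ((Set.Iic a).indicator fun _ => 1) = fun t => C.ext a t :=
    funext fun t => C.transpose.average_indicator_Iic a t
  have e2 : ∀ t, (Set.Iic a).indicator (fun _ => (1 : ℝ)) t * deriv (C.average g) t =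
      (Set.Iic a).indicator (deriv (C.average g)) t := fun t => by
    by_cases h : t ∈ Set.Iic a <;> simp [h]
  simp only [e1, e2]
  rw [integral_indicator_Iic, C.integral_deriv_average hg, C.average_projIcc]
  rfl

theorem pairingDefect_indicator (C : Copula) (hg : IsBoundedMeasurable g) {s : Set ℝ}
    (hs : MeasurableSet s) : C.pairingDefect g (s.indicator fun _ => 1) = 0 := by
  have hb : ∀ {s : Set ℝ}, MeasurableSet s → IsBoundedMeasurable (s.indicator fun _ => (1 : ℝ)) :=
    fun h => (IsBoundedMeasurable.const 1).indicator h
  induction s, hs using MeasurableSpace.induction_on_inter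
    (borel_eq_generateFrom_Iic ℝ ▸ BorelSpace.measurable_eq) isPiSystem_Iic with
  | empty => simpa using C.pairingDefect_const_mul (g := g) 0 fun _ => 0
  | basic s hs =>
    obtain ⟨a, rfl⟩ := hs
    exact C.pairingDefect_indicator_Iic hg a
  | compl s hs ih =>
    -- On $(0,1)$ the constant $1$ agrees with the indicator of $(-\infty,1]$, already handled, so
    -- the approximant is at $L^1$ distance zero.
    refine C.pairingDefect_eq_zero_of_approx hg (hb hs.compl) fun ε hε =>
      ⟨fun t => (Set.Iic 1).indicator (fun _ => 1) t + (-1) * s.indicator (fun _ => 1) t,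
        (hb measurableSet_Iic).add ((IsBoundedMeasurable.const _).mul (hb hs)), ?_, ?_⟩
    · rw [C.pairingDefect_add hg (hb measurableSet_Iic)
        ((IsBoundedMeasurable.const _).mul (hb hs)), C.pairingDefect_const_mul, ih,
        C.pairingDefect_indicator_Iic hg]
      simp
    · refine le_of_eq_of_le ?_ hε.le
      rw [integral_congr_Ioo (g := fun _ => 0) zero_le_one]
      · simp
      · intro t ht
        have : t ∈ Set.Iic (1 : ℝ) := ht.2.le
        by_cases h : t ∈ s <;> simp [h, this]
  | iUnion A hd hA ih =>
    have hsum : ∀ n : Finset ℕ, IsBoundedMeasurable (fun t => ∑ i ∈ n, (A i).indicator (fun _ => 1) t)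
        ∧ C.pairingDefect g (fun t => ∑ i ∈ n, (A i).indicator (fun _ => 1) t) = 0 := by
      intro n
      induction n using Finset.induction_on with
      | empty =>
        exact ⟨by simpa using IsBoundedMeasurable.const 0, by
          simpa using C.pairingDefect_const_mul (g := g) 0 fun _ => 0⟩
      | insert i n hi hn =>
        simp only [Finset.sum_insert hi]
        exact ⟨(hb (hA i)).add hn.1, by
          rw [C.pairingDefect_add hg (hb (hA i)) hn.1, ih, hn.2, add_zero]⟩
    have hU := hb (MeasurableSet.iUnion hA)
    -- Finite partial unions converge in $L^1$ by dominated convergence; disjointness turns their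
    -- indicators into sums.
    have hlim : Tendsto (fun n : Finset ℕ => ∫ t in (0 : ℝ)..1,
        |(⋃ i, A i).indicator (fun _ => (1 : ℝ)) t - ∑ i ∈ n, (A i).indicator (fun _ => 1) t|)
        atTop (𝓝 (∫ t in (0 : ℝ)..1, (0 : ℝ))) := by
      refine intervalIntegral.tendsto_integral_filter_of_dominated_convergence (fun _ => 1)
        (Eventually.of_forall fun n => (hU.sub (hsum n).1).abs.1.aestronglyMeasurable)
        (Eventually.of_forall fun n => Eventually.of_forall fun t _ => ?_)
        intervalIntegrable_const (Eventually.of_forall fun t _ => ?_)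
      · rw [← Finset.indicator_biUnion_apply n A fun i _ j _ hij => hd hij,
          Real.norm_eq_abs, abs_abs]
        by_cases h : t ∈ ⋃ i ∈ n, A i
        · have h' : t ∈ ⋃ i, A i := Set.iUnion₂_subset_iUnion _ _ h
          rw [Set.indicator_of_mem h, Set.indicator_of_mem h']
          simp
        · rw [Set.indicator_of_notMem h]
          by_cases h' : t ∈ ⋃ i, A i
          · rw [Set.indicator_of_mem h']; simp
          · rw [Set.indicator_of_notMem h']; simp
      · have := tendsto_indicator_biUnion_finset A (fun _ => (1 : ℝ)) t
        refine tendsto_const_nhds.congr' ?_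
        filter_upwards [tendsto_pure.1 this] with n hn
        rw [← Finset.indicator_biUnion_apply n A fun i _ j _ hij => hd hij, hn]
        simp
    refine C.pairingDefect_eq_zero_of_approx hg hU fun ε hε => ?_
    rw [intervalIntegral.integral_zero] at hlim
    obtain ⟨n, hn⟩ := (hlim.eventually_le_const hε).exists
    exact ⟨_, (hsum n).1, (hsum n).2, hn⟩

/-- The zero set is closed under sums and contains multiples of indicators, hence is $L^1$-dense; by
continuity it is everything. -/
theorem pairingDefect_eq_zero (C : Copula) (hg : IsBoundedMeasurable g)
    (hf : IsBoundedMeasurable f) : C.pairingDefect g f = 0 := by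
  refine C.pairingDefect_eq_zero_of_approx hg hf fun ε hε => ?_
  have hm : MemLp f 1 (volume.restrict (Set.Ioc (0 : ℝ) 1)) :=
    memLp_one_iff_integrable.2 (hf.integrable _)
  obtain ⟨f', hd, hf', h0⟩ := hm.induction_dense ENNReal.one_ne_top
    (fun f => IsBoundedMeasurable f ∧ C.pairingDefect g f = 0)
    (fun c s hs _ δ hδ => ⟨s.indicator fun _ => c, by simp,
      (IsBoundedMeasurable.const c).indicator hs, by
        have := C.pairingDefect_const_mul (g := g) c (s.indicator fun _ => 1)
        rw [C.pairingDefect_indicator hg hs, mul_zero] at this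
        convert this using 2
        funext t
        by_cases h : t ∈ s <;> simp [h]⟩)
    (fun f₁ f₂ h₁ h₂ => ⟨h₁.1.add h₂.1, by
      have := C.pairingDefect_add hg h₁.1 h₂.1
      rw [h₁.2, h₂.2, add_zero] at this
      exact this⟩)
    (fun f h => h.1.1.aestronglyMeasurable) (ε := ENNReal.ofReal ε) (by simpa using hε)
  refine ⟨f', hf', h0, ?_⟩
  rw [intervalIntegral.integral_of_le zero_le_one]
  rw [eLpNorm_one_eq_lintegral_enorm] at hd
  have := integral_norm_eq_lintegral_enorm (μ := volume.restrict (Set.Ioc (0 : ℝ) 1))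
    (hf.sub hf').1.aestronglyMeasurable
  simp only [Real.norm_eq_abs] at this
  rw [this]
  exact ENNReal.toReal_le_of_le_ofReal hε.le hd

/-- The conditional expectations in the two directions are adjoint to each other. -/
theorem integral_deriv_average_mul (C : Copula) (hf : IsBoundedMeasurable f)
    (hg : IsBoundedMeasurable g) :
    ∫ t in (0 : ℝ)..1, deriv (C.transpose.average f) t * g t =
      ∫ t in (0 : ℝ)..1, f t * deriv (C.average g) t := by
  have h := C.pairingDefect_eq_zero hg hf
  rwa [pairingDefect, intervalIntegral.integral_sub
    (((C.transpose.isBoundedMeasurable_deriv_average hf).mul hg).intervalIntegrable _ _)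
    ((hf.mul (C.isBoundedMeasurable_deriv_average hg)).intervalIntegrable _ _), sub_eq_zero] at h

/-! ### Copulas as a monoid with involution -/

theorem eq_of_ext_eq {C D : Copula} (h : ∀ x ∈ Set.Icc (0 : ℝ) 1, ∀ y ∈ Set.Icc (0 : ℝ) 1,
    C.ext x y = D.ext x y) : C = D := by
  have : C.toFun = D.toFun := by
    funext x y
    refine Subtype.ext ?_
    simpa [ext] using h x x.2 y y.2
  cases C
  cases D
  simpa using this

theorem starFun_eq_average (C D : Copula) (x y : ℝ) :
    C.starFun D x y = C.average (fun t => D.partial₁ t y) x := rfl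

theorem ext_mul (C D : Copula) (x y : ℝ) : (C * D).ext x y = C.starFun D x y := by
  change C.starFun D (Set.projIcc (0 : ℝ) 1 zero_le_one x) (Set.projIcc (0 : ℝ) 1 zero_le_one y) = _
  rw [starFun_eq_average, average_projIcc, ← starFun_eq_average, starFun_transpose,
    starFun_eq_average, average_projIcc, ← starFun_eq_average, ← starFun_transpose]

theorem transpose_mul (C D : Copula) : (C * D).transpose = D.transpose * C.transpose :=
  eq_of_ext_eq fun x _ y _ =>
    (C.ext_mul D y x).trans ((C.starFun_transpose D y x).trans (ext_mul _ _ _ _).symm)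

theorem partial₁_mul (C D : Copula) (x y : ℝ) :
    (C * D).partial₁ x y = deriv (C.average fun t => D.partial₁ t y) x :=
  congrArg (deriv · x) (funext fun s => C.ext_mul D s y)

theorem partial₂_mul (C D : Copula) (x y : ℝ) :
    (C * D).partial₂ x y = deriv (D.transpose.average fun t => C.partial₂ x t) y :=
  congrArg (deriv · y) (funext fun s => (C.ext_mul D x s).trans (C.starFun_transpose D x s))

/-- Both sides at $(x,y)$ pair $\partial_2A(x,\cdot)$ with $\partial_1C(\cdot,y)$ through $B$, with
the conditional expectation moved from one factor to the other. -/
protected theorem mul_assoc (A B C : Copula) : A * B * C = A * (B * C) := by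
  refine eq_of_ext_eq fun x _ y _ => ?_
  rw [ext_mul, ext_mul, starFun, starFun]
  simp only [partial₂_mul, partial₁_mul]
  exact B.integral_deriv_average_mul (A.isBoundedMeasurable_partial₂ x)
    (C.isBoundedMeasurable_partial₁ y)

/-- The upper Fréchet–Hoeffding bound `M(x, y) = min x y`. -/
def comonotone : Copula where
  toFun x y := min x y
  zero_right u := min_eq_right u.2.1
  zero_left v := min_eq_left v.2.1
  one_right u := min_eq_left u.2.2
  one_left v := min_eq_right v.2.2
  rect_nonneg u v x y hx hy := by
    have hx' : (x : ℝ) ≤ u := hx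
    have hy' : (y : ℝ) ≤ v := hy
    have hmin : ∀ a b : I, ((min a b : I) : ℝ) = min (a : ℝ) b := fun a b =>
      (Subtype.mono_coe _).map_min
    rw [hmin, hmin, hmin, hmin]
    grind

theorem transpose_comonotone : comonotone.transpose = comonotone :=
  eq_of_ext_eq fun x _ y _ => by simp [ext, transpose, comonotone, min_comm]

theorem comonotone_mul (C : Copula) : comonotone * C = C := by
  refine eq_of_ext_eq fun x hx y _ => ?_
  rw [ext_mul, starFun]
  have h : ∫ t in (0 : ℝ)..1, comonotone.partial₂ x t * C.partial₁ t y =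
      ∫ t in (0 : ℝ)..1, (Set.Iic x).indicator (fun t => C.partial₁ t y) t := by
    rw [intervalIntegral.integral_of_le zero_le_one, intervalIntegral.integral_of_le zero_le_one,
      integral_Ioc_eq_integral_Ioo, integral_Ioc_eq_integral_Ioo]
    refine setIntegral_congr_ae measurableSet_Ioo ?_
    -- Away from the kink $t=x$, $\partial_2M(x,t)$ is $1$ for $t<x$ and $0$ for $t>x$.
    filter_upwards [compl_mem_ae_iff.2 (measure_singleton x)] with t hne ht
    have hext : ∀ s ∈ Set.Ioo (0 : ℝ) 1, comonotone.ext x s = min x s := fun s hs => by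
      simp [ext, comonotone, Set.projIcc_of_mem _ hx,
        Set.projIcc_of_mem _ (Set.Ioo_subset_Icc_self hs)]
    rcases lt_or_gt_of_ne hne with hlt | hlt
    · have : (fun s => comonotone.ext x s) =ᶠ[𝓝 t] fun s => s := by
        filter_upwards [isOpen_Ioo.mem_nhds ht, Iio_mem_nhds hlt] with s hs hs'
        rw [hext s hs, min_eq_right (le_of_lt hs')]
      rw [partial₂, this.deriv_eq, deriv_id'', one_mul,
        Set.indicator_of_mem (show t ∈ Set.Iic x from hlt.le)]
    · have : (fun s => comonotone.ext x s) =ᶠ[𝓝 t] fun _ => x := by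
        filter_upwards [isOpen_Ioo.mem_nhds ht, Ioi_mem_nhds hlt] with s hs hs'
        rw [hext s hs, min_eq_left (le_of_lt hs')]
      rw [partial₂, this.deriv_eq, deriv_const, zero_mul,
        Set.indicator_of_notMem (show t ∉ Set.Iic x from not_le.2 hlt)]
  rw [h, integral_indicator_Iic]
  exact (C.transpose.integral_partial₂ y _).trans (C.ext_projIcc_left x y)

theorem mul_comonotone (C : Copula) : C * comonotone = C := by
  have h := congrArg transpose (comonotone_mul C.transpose)
  rwa [transpose_mul, transpose_comonotone] at h

/-- A copula is invertible if its transpose is a two-sided inverse of it. -/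
def Invertible (C : Copula) : Prop :=
  C.transpose * C = comonotone ∧ C * C.transpose = comonotone

theorem Invertible.transpose {C : Copula} (h : C.Invertible) : C.transpose.Invertible :=
  ⟨h.2, h.1⟩

theorem Invertible.mul {C D : Copula} (hC : C.Invertible) (hD : D.Invertible) :
    (C * D).Invertible := by
  constructor
  · rw [transpose_mul, Copula.mul_assoc, ← Copula.mul_assoc C.transpose, hC.1, comonotone_mul, hD.1]
  · rw [transpose_mul, Copula.mul_assoc, ← Copula.mul_assoc D, hD.2, comonotone_mul, hC.2]

theorem Invertible.of_mul_left {C D : Copula} (hC : C.Invertible) (h : (C * D).Invertible) :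
    D.Invertible := by
  have := hC.transpose.mul h
  rwa [← Copula.mul_assoc, hC.1, comonotone_mul] at this

theorem Invertible.of_mul_right {C D : Copula} (hD : D.Invertible) (h : (C * D).Invertible) :
    C.Invertible := by
  have := h.mul hD.transpose
  rwa [Copula.mul_assoc, hD.2, mul_comonotone] at this

/-! ### The Sobolev norm -/

theorem continuous_uncurry_ext (C : Copula) : Continuous (Function.uncurry C.ext) :=
  (LipschitzWith.uncurry (fun y => C.transpose.lipschitz_right y)
    (fun x => C.lipschitz_right x)).continuous

theorem measurable_uncurry_partial₂ (C : Copula) : Measurable (Function.uncurry C.partial₂) :=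
  measurable_deriv_with_param C.continuous_uncurry_ext

theorem continuous_ext_diag (C : Copula) : Continuous fun t => C.ext t t :=
  C.continuous_uncurry_ext.comp (continuous_id.prodMk continuous_id)

theorem ext_le_left (C : Copula) {x : ℝ} (hx : x ∈ Set.Icc (0 : ℝ) 1) (y : ℝ) :
    C.ext x y ≤ x := by
  -- Taking `max 1 y` avoids a case split on $y>1$; clamping reduces it to $1$.
  have h : C.ext x y ≤ C.ext x (max 1 y) := C.monotone_right x (le_max_right _ _)
  have h1 : C.ext x (max 1 y) = C.ext 1 x :=
    (C.transpose.ext_one_le_left (le_max_left _ _) x).trans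
      ((C.transpose.ext_one_left x).trans (C.ext_one_left x).symm)
  rwa [h1, C.ext_one_left, Set.projIcc_of_mem _ hx] at h

/-- $M$ bounds every copula from above; monotonicity from the diagonal point $(m,m)$, $m=\min(x,y)$,
gives the reverse bound. -/
theorem eq_comonotone_of_diag (C : Copula) (h : ∀ t ∈ Set.Icc (0 : ℝ) 1, C.ext t t = t) :
    C = comonotone := by
  refine eq_of_ext_eq fun x hx y hy => ?_
  have e : comonotone.ext x y = min x y := by
    simp [ext, comonotone, Set.projIcc_of_mem _ hx, Set.projIcc_of_mem _ hy]
  rw [e]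
  refine le_antisymm (le_min (C.ext_le_left hx y) (C.transpose.ext_le_left hy x)) ?_
  rcases le_total x y with hxy | hxy
  · rw [min_eq_left hxy]
    exact (h x hx).symm.le.trans (C.monotone_right x hxy)
  · rw [min_eq_right hxy]
    exact (h y hy).symm.le.trans (C.transpose.monotone_right y hxy)

theorem ext_diag_comonotone {t : ℝ} (ht : t ∈ Set.Icc (0 : ℝ) 1) : comonotone.ext t t = t := by
  simp [ext, comonotone, Set.projIcc_of_mem _ ht]

theorem integral_diag_comonotone : ∫ t in (0 : ℝ)..1, comonotone.ext t t = 1 / 2 := by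
  rw [integral_congr_Ioo (g := fun t => t) zero_le_one
    fun t ht => ext_diag_comonotone (Set.Ioo_subset_Icc_self ht)]
  simp

theorem integral_diag_le (C : Copula) : ∫ t in (0 : ℝ)..1, C.ext t t ≤ 1 / 2 := by
  rw [← integral_diag_comonotone]
  refine intervalIntegral.integral_mono_on zero_le_one
    (C.continuous_ext_diag.intervalIntegrable _ _)
    (comonotone.continuous_ext_diag.intervalIntegrable _ _) fun t ht => ?_
  rw [ext_diag_comonotone ht]
  exact C.ext_le_left ht t

theorem integral_diag_eq_iff (C : Copula) :
    ∫ t in (0 : ℝ)..1, C.ext t t = 1 / 2 ↔ C = comonotone := by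
  refine ⟨fun h => C.eq_comonotone_of_diag ?_, fun h => h ▸ integral_diag_comonotone⟩
  by_contra! hne
  obtain ⟨t, ht, htne⟩ := hne
  have := intervalIntegral.integral_lt_integral_of_continuousOn_of_le_of_exists_lt zero_lt_one
    C.continuous_ext_diag.continuousOn (continuous_id (X := ℝ)).continuousOn
    (fun t ht => C.ext_le_left (Set.Ioc_subset_Icc_self ht) t)
    ⟨t, ht, lt_of_le_of_ne (C.ext_le_left ht t) htne⟩
  simp only [id, integral_id] at this
  rw [h] at this
  norm_num at this

theorem integral_sq_partial₂ (C : Copula) (x : ℝ) :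
    ∫ t in (0 : ℝ)..1, C.partial₂ x t ^ 2 = (C * C.transpose).ext x x := by
  rw [ext_mul, starFun]
  exact intervalIntegral.integral_congr fun t _ => sq _

theorem integrable_sq_partial₂ (C : Copula) (μ : Measure (ℝ × ℝ)) [IsFiniteMeasure μ] :
    Integrable (fun p : ℝ × ℝ => C.partial₂ p.1 p.2 ^ 2) μ := by
  refine Integrable.of_bound (C.measurable_uncurry_partial₂.pow_const 2).aestronglyMeasurable 1
    (Eventually.of_forall fun p => ?_)
  rw [Real.norm_eq_abs, abs_of_nonneg (sq_nonneg _)]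
  exact pow_le_one₀ (C.partial₂_nonneg _ _) (C.partial₂_le_one _ _)

theorem norm_eq_sqrt_integral_diag (C : Copula) :
    ‖C‖ = √((∫ y in (0 : ℝ)..1, (C.transpose * C).ext y y) +
      ∫ x in (0 : ℝ)..1, (C * C.transpose).ext x x) := by
  have hb₁ : ∀ y, IsBoundedMeasurable fun x => C.partial₁ x y ^ 2 := fun y => by
    simpa only [sq] using (C.isBoundedMeasurable_partial₁ y).mul (C.isBoundedMeasurable_partial₁ y)
  have hb₂ : ∀ y, IsBoundedMeasurable fun x => C.partial₂ x y ^ 2 := fun y =>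
    ⟨(C.measurable_uncurry_partial₂.of_uncurry_right).pow_const 2, 1, fun x => by
      rw [abs_of_nonneg (sq_nonneg _)]
      exact pow_le_one₀ (C.partial₂_nonneg _ _) (C.partial₂_le_one _ _)⟩
  have h1 : ∀ y, ∫ x in (0 : ℝ)..1, (C.partial₁ x y ^ 2 + C.partial₂ x y ^ 2) =
      (C.transpose * C).ext y y + ∫ x in (0 : ℝ)..1, C.partial₂ x y ^ 2 := fun y => by
    rw [intervalIntegral.integral_add ((hb₁ y).intervalIntegrable _ _)
      ((hb₂ y).intervalIntegrable _ _)]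
    exact congrArg (· + _) (C.transpose.integral_sq_partial₂ y)
  have hint := C.integrable_sq_partial₂
    ((volume.restrict (Set.Ioc (0 : ℝ) 1)).prod (volume.restrict (Set.Ioc (0 : ℝ) 1)))
  -- The norm integrates over $x$ first, but $(\partial_2C)^2$ gives a diagonal value only when
  -- integrated over $y$ first: Fubini.
  have hswap : ∫ y in (0 : ℝ)..1, ∫ x in (0 : ℝ)..1, C.partial₂ x y ^ 2 =
      ∫ x in (0 : ℝ)..1, (C * C.transpose).ext x x := by
    simp only [← integral_sq_partial₂, intervalIntegral.integral_of_le zero_le_one]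
    exact (integral_integral_swap hint).symm
  change √(∫ y in (0 : ℝ)..1, ∫ x in (0 : ℝ)..1, (C.partial₁ x y ^ 2 + C.partial₂ x y ^ 2)) = _
  simp only [h1]
  rw [intervalIntegral.integral_add ((C.transpose * C).continuous_ext_diag.intervalIntegrable _ _),
    hswap]
  rw [intervalIntegrable_iff_integrableOn_Ioc_of_le zero_le_one]
  simpa only [IntegrableOn, intervalIntegral.integral_of_le zero_le_one] using
    hint.integral_prod_right

/-- Two terms, each at most $1/2$, sum to $1$ only if both equal $1/2$. -/
theorem norm_eq_one_iff (C : Copula) : ‖C‖ = 1 ↔ C.Invertible := by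
  rw [norm_eq_sqrt_integral_diag, Real.sqrt_eq_one, Invertible, ← integral_diag_eq_iff,
    ← integral_diag_eq_iff]
  have h1 := (C.transpose * C).integral_diag_le
  have h2 := (C * C.transpose).integral_diag_le
  constructor
  · intro h
    constructor <;> linarith
  · rintro ⟨h3, h4⟩
    linarith

end Copula

theorem mainTheorem5 (U V : Copula) :
    (‖U‖ = 1 → ‖V‖ = 1 → ‖U * V‖ = 1) ∧
      (‖U * V‖ = 1 → (‖U‖ = 1 ↔ ‖V‖ = 1)) := by
  simp only [Copula.norm_eq_one_iff]
  exact ⟨fun hU hV => hU.mul hV, fun h => ⟨fun hU => hU.of_mul_left h, fun hV => hV.of_mul_right h⟩⟩
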